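/- \textbf{Terms.} The terms of the $\lambda\bot$-calculus are $M ::= x \mid \bot \mid \lambda x.M \mid MM$ (up to renaming of bound variables). Reduction is the compatible closure of $(\lambda x.M)N \to M\{N/x\}$, $\bot M\to\bot$ and $\lambda x.\bot\to\bot$, and $M=N$ means that $M$ and $N$ reduce (in finitely many steps) to a common term. Put ${\bf I}=\lambda x.x$ and $M\circ N={\bf B}MN$ with ${\bf B}=\lambda xyz.x(yz)$. A term $M$ is \emph{right invertible} if $M\circ R={\bf I}$ for some term $R$. \textbf{Types.} Strict types $\mu,\nu$ and intersections $\sigma,\tau,\rho$ are given by $\mu ::= \varphi \mid \omega \mid \sigma\to\mu$ and $\sigma ::= \mu \mid \sigma\wedge\sigma$, where $\varphi$ ranges over type variables; $\wedge$ is taken modulo idempotence, commutativity and associativity. Let $\leq$ be the least reflexive and transitive relation with $\sigma\leq\omega$; $\omega\leq\omega\to\omega$; $\sigma_1\wedge\sigma_2\leq\sigma_i$ ($i=1,2$); $\sigma_1\wedge\sigma_2\leq\tau_1\wedge\tau_2$ whenever $\sigma_1\leq\tau_1$ and $\sigma_2\leq\tau_2$; and $\sigma_1\to\mu_1\leq\sigma_2\to\mu_2$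 whenever $\sigma_2\leq\sigma_1$ and $\mu_1\leq\mu_2$. Write $\sigma\sim\tau$ if $\sigma\leq\tau\leq\sigma$. \textbf{Typing.} $\Gamma\vdash M:\mu$ is defined by the following rules, where $\Gamma\vdash N:\bigwedge_{i\in I}\mu_i$ abbreviates $\Gamma\vdash N:\mu_i$ for all $i\in I$: $\Gamma,x:\bigwedge_{i\in I}\mu_i\vdash x:\mu_j$ for $j\in I$; $\Gamma\vdash M:\omega$; if $\Gamma\vdash M:\mu$ and $\mu\leq\nu$ then $\Gamma\vdash M:\nu$; if $\Gamma,x:\sigma\vdash M:\mu$ then $\Gamma\vdash\lambda x.M:\sigma\to\mu$; if $\Gamma\vdash M:\sigma\to\mu$ and $\Gamma\vdash N:\sigma$ then $\Gamma\vdash MN:\mu$. A term $M$ \emph{inhabits} $\mu$ if $\vdash M:\mu$ in the empty environment. For $\rho=\bigwedge_{i\in I}\mu_i$, we say that $\tau\to\rho$ is \emph{inhabited} if a single term inhabits all the types $\tau\to\mu_i$, $i\in I$. \textbf{Right types.} A type $\tau\to\mu$ is a \emph{right type} if there are $m\geq 0$ and intersections $\rho_1,\dots,\rho_m$ such that $\tau\leq\rho_1\to\dots\to\rho_m\to\mu$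 and $\tau\to\rho_i$ is inhabited for $1\leq i\leq m$. More generally, a strict type $\nu$ is called a right type if $\nu\sim\tau\to\mu$ for some right type $\tau\to\mu$ of this form (so $\omega\sim\omega\to\omega$ is a right type). \textbf{Lemma (Characterisation of Types for Right Invertible Terms).} \begin{enumerate} \item If a right invertible term inhabits a strict type $\nu$, then $\nu$ is a right type. If moreover $\nu$ is itself an arrow type $\tau\to\mu$, then there are $m\ge 0$ and $\rho_1,\dots,\rho_m$ with $\tau\leq\rho_1\to\dots\to\rho_m\to\mu$ and each $\tau\to\rho_i$ inhabited. \item Every right type is inhabited by a right invertible term. \end{enumerate} -/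

import Mathlib

namespace LamBot

/-! ### The `λ⊥`-calculus -/

/-- Terms of the `λ⊥`-calculus up to renaming of bound variables, in de Bruijn notation: the
variable `var n` under `k ≤ n` abstractions is the free variable number `n - k`. -/
inductive Term : Type
  | var (n : ℕ) : Term
  | bot : Term
  | lam (M : Term) : Term
  | app (M N : Term) : Term

namespace Term

/-- Lifting of a renaming under an abstraction. -/
def upRen (ξ : ℕ → ℕ) : ℕ → ℕ
  | 0 => 0
  | n + 1 => ξ n + 1

/-- Capture-avoiding renaming of the free variables. -/
def rename : (ℕ → ℕ) → Term → Term
  | ξ, var n => var (ξ n)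
  | _, bot => bot
  | ξ, lam M => lam (rename (upRen ξ) M)
  | ξ, app M N => app (rename ξ M) (rename ξ N)

/-- Lifting of a substitution under an abstraction. -/
def up (s : ℕ → Term) : ℕ → Term
  | 0 => var 0
  | n + 1 => rename Nat.succ (s n)

/-- Capture-avoiding simultaneous substitution for the free variables. -/
def subst : (ℕ → Term) → Term → Term
  | s, var n => s n
  | _, bot => bot
  | s, lam M => lam (subst (up s) M)
  | s, app M N => app (subst s M) (subst s N)

/-- The substitution that sends variable `0` to `N` and lowers the other variables by one. -/
def single (N : Term) : ℕ → Term
  | 0 => N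
  | n + 1 => var n

/-- The contractum `M{N/x}` of the redex `(λx.M)N`. -/
def inst (M N : Term) : Term := subst (single N) M

/-- One-step `β⊥`-reduction: the compatible closure of
`(λx.M)N ⟶ M{N/x}`, `⊥M ⟶ ⊥` and `λx.⊥ ⟶ ⊥`. -/
inductive Step : Term → Term → Prop
  | beta (M N : Term) : Step (app (lam M) N) (inst M N)
  | botApp (M : Term) : Step (app bot M) bot
  | botLam : Step (lam bot) bot
  | lam {M M' : Term} : Step M M' → Step (lam M) (lam M')
  | appLeft {M M' : Term} (N : Term) : Step M M' → Step (app M N) (app M' N)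
  | appRight (M : Term) {N N' : Term} : Step N N' → Step (app M N) (app M N')

/-- Many-step `β⊥`-reduction. -/
def Reduces : Term → Term → Prop := Relation.ReflTransGen Step

/-- Equality of terms: `M = N` when both reduce to a common term. -/
def Conv (M N : Term) : Prop := ∃ P : Term, Reduces M P ∧ Reduces N P

/-- `I = λx.x`. -/
def I : Term := lam (var 0)

/-- `B = λxyz.x(yz)`. -/
def B : Term := lam (lam (lam (app (var 2) (app (var 1) (var 0)))))

/-- `M ∘ N = B M N`. -/
def comp (M N : Term) : Term := app (app B M) N

/-- `M` is right invertible: `M ∘ R = I` for some term `R`. -/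
def RightInvertible (M : Term) : Prop := ∃ R : Term, Conv (comp M R) I

end Term

/-! ### Strict intersection types -/

mutual

/-- Strict intersection types `μ ::= φ ∣ ω ∣ σ → μ`. -/
inductive Strict : Type
  | var (n : ℕ) : Strict
  | omega : Strict
  | arrow (σ : Inter) (μ : Strict) : Strict

/-- Intersections `σ ::= μ ∣ σ ∧ σ`. -/
inductive Inter : Type
  | strict (μ : Strict) : Inter
  | inter (σ τ : Inter) : Inter

end

/-- The strict types `μ_i` of an intersection `σ = ⋀_{i ∈ I} μ_i`. -/
def Inter.components : Inter → List Strict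
  | .strict μ => [μ]
  | .inter σ τ => σ.components ++ τ.components

/-- The subtyping preorder. Intersections are meant modulo idempotence, commutativity and
associativity of `∧`. They are represented here by raw syntax, and the rule `idem` accounts for
these identifications: with it the two sides of each of them (anywhere inside a type) are
equivalent for the preorder, see `equiv_idem`, `equiv_comm`, `equiv_assoc`, `equiv_inter` and
`equiv_arrow` below. -/
inductive Le : Inter → Inter → Prop
  | refl (σ : Inter) : Le σ σ
  | trans {σ τ ρ : Inter} : Le σ τ → Le τ ρ → Le σ ρ
  | idem (σ : Inter) : Le σ (.inter σ σ)
  | omega (σ : Inter) : Le σ (.strict .omega)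
  | omegaArrow : Le (.strict .omega) (.strict (.arrow (.strict .omega) .omega))
  | interLeft (σ τ : Inter) : Le (.inter σ τ) σ
  | interRight (σ τ : Inter) : Le (.inter σ τ) τ
  | inter {σ₁ σ₂ τ₁ τ₂ : Inter} : Le σ₁ τ₁ → Le σ₂ τ₂ → Le (.inter σ₁ σ₂) (.inter τ₁ τ₂)
  | arrow {σ₁ σ₂ : Inter} {μ₁ μ₂ : Strict} : Le σ₂ σ₁ → Le (.strict μ₁) (.strict μ₂) →
      Le (.strict (.arrow σ₁ μ₁)) (.strict (.arrow σ₂ μ₂))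

/-- `σ ∼ τ`: `σ ≤ τ` and `τ ≤ σ`. -/
def Equiv (σ τ : Inter) : Prop := Le σ τ ∧ Le τ σ

theorem equiv_idem (σ : Inter) : Equiv (.inter σ σ) σ := ⟨.interLeft σ σ, .idem σ⟩

theorem Le.glb {σ τ ρ : Inter} (h₁ : Le ρ σ) (h₂ : Le ρ τ) : Le ρ (.inter σ τ) :=
  .trans (.idem ρ) (.inter h₁ h₂)

theorem equiv_comm (σ τ : Inter) : Equiv (.inter σ τ) (.inter τ σ) :=
  ⟨.glb (.interRight σ τ) (.interLeft σ τ), .glb (.interRight τ σ) (.interLeft τ σ)⟩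

theorem equiv_assoc (σ τ ρ : Inter) :
    Equiv (.inter (.inter σ τ) ρ) (.inter σ (.inter τ ρ)) :=
  ⟨.glb (.trans (.interLeft _ _) (.interLeft _ _))
      (.inter (.interRight _ _) (.refl _)),
    .glb (.inter (.refl _) (.interLeft _ _))
      (.trans (.interRight _ _) (.interRight _ _))⟩

theorem equiv_inter {σ₁ σ₂ τ₁ τ₂ : Inter} (h₁ : Equiv σ₁ τ₁) (h₂ : Equiv σ₂ τ₂) :
    Equiv (.inter σ₁ σ₂) (.inter τ₁ τ₂) :=
  ⟨.inter h₁.1 h₂.1, .inter h₁.2 h₂.2⟩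

theorem equiv_arrow {σ τ : Inter} {μ ν : Strict} (h₁ : Equiv σ τ)
    (h₂ : Equiv (.strict μ) (.strict ν)) :
    Equiv (.strict (.arrow σ μ)) (.strict (.arrow τ ν)) :=
  ⟨.arrow h₁.2 h₂.1, .arrow h₁.1 h₂.2⟩

/-! ### Type assignment -/

/-- The essential intersection type assignment system, `Γ ⊢ M : μ`. The entry number `n` of the
environment `Γ` is the intersection assigned to the variable `n`; variables with a number
`≥ Γ.length` have no type in `Γ`. The second premise of `arrowE` is `Γ ⊢ N : σ`, i.e.
`Γ ⊢ N : μ_i` for each `μ_i` in `σ = ⋀_{i ∈ I} μ_i`. -/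
inductive Typed : List Inter → Term → Strict → Prop
  | ax {Γ : List Inter} {n : ℕ} {σ : Inter} {μ : Strict} :
      Γ[n]? = some σ → μ ∈ σ.components → Typed Γ (.var n) μ
  | omega (Γ : List Inter) (M : Term) : Typed Γ M .omega
  | sub {Γ : List Inter} {M : Term} {μ ν : Strict} :
      Typed Γ M μ → Le (.strict μ) (.strict ν) → Typed Γ M ν
  | arrowI {Γ : List Inter} {M : Term} {σ : Inter} {μ : Strict} :
      Typed (σ :: Γ) M μ → Typed Γ (.lam M) (.arrow σ μ)
  | arrowE {Γ : List Inter} {M N : Term} {σ : Inter} {μ : Strict} :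
      Typed Γ M (.arrow σ μ) → (∀ ν ∈ σ.components, Typed Γ N ν) → Typed Γ (.app M N) μ

/-- The term `M` inhabits the type `μ`: `⊢ M : μ` in the empty environment. -/
def Inhabits (M : Term) (μ : Strict) : Prop := Typed [] M μ

/-- `σ → τ` is inhabited, where `τ = ⋀_{i ∈ I} μ_i`: a single term inhabits all the types
`σ → μ_i`. -/
def ArrowInhabited (σ τ : Inter) : Prop :=
  ∃ M : Term, ∀ μ ∈ τ.components, Inhabits M (.arrow σ μ)

/-- `arrows [ρ₁, …, ρ_m] μ` is `ρ₁ → … → ρ_m → μ`. -/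
def arrows : List Inter → Strict → Strict
  | [], μ => μ
  | ρ :: ρs, μ => .arrow ρ (arrows ρs μ)

/-- The arrow type `τ → μ` is a right type: for some `m ≥ 0` and `ρ₁, …, ρ_m` we have
`τ ≤ ρ₁ → … → ρ_m → μ`, and each `τ → ρ_i` is inhabited. -/
def IsRightArrow (τ : Inter) (μ : Strict) : Prop :=
  ∃ ρs : List Inter, Le τ (.strict (arrows ρs μ)) ∧ ∀ ρ ∈ ρs, ArrowInhabited τ ρ

/-- A strict type is a right type if it is, up to `∼`, an arrow type which is a right type.
(So `ω`, being equivalent to `ω → ω`, is a right type.) -/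
def IsRightType (ν : Strict) : Prop :=
  ∃ (τ : Inter) (μ : Strict), Equiv (.strict ν) (.strict (.arrow τ μ)) ∧ IsRightArrow τ μ

end LamBot

namespace LamBot

open Relation

namespace Term

/-! ### Substitution algebra -/

-- If `M ∘ R = I`, then `M(Rx)` reduces to `x`. By standardization (`Reduces.st`) weak head
-- β-reduction alone leads from `M(Rx)` to `x`. Since `M(Rx)` is `Mx` with `Rx` put for `x`, the
-- weak head reduction of `Mx` reaches a head variable; this variable is `x`, for any other one
-- would survive the substitution as head. So `Mx` weak head reduces to `x N₁ … N_m`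
-- (`RightInvertible.exists_spine`). If `M : τ → μ`, then subject reduction types `x N₁ … N_m` with
-- `μ` under `x : τ`. Inverting the applications yields `τ ≤ ρ₁ → … → ρ_m → μ` and `N_i : ρ_i`, and
-- `λx.N_i` inhabits `τ → ρ_i`. A type variable cannot be a type of `M`, so only `ω ∼ ω → ω` and
-- arrows remain. Conversely, if `N_i` inhabits `τ → ρ_i`, then `λx.x(N₁x)…(N_m x)` inhabits `τ →
-- μ`, and `λy x₁ … x_m.y` is a right inverse of it.

theorem rename_rename (ξ ζ : ℕ → ℕ) (M : Term) :
    rename ζ (rename ξ M) = rename (fun n => ζ (ξ n)) M := by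
  induction M generalizing ξ ζ with
  | var n => rfl
  | bot => rfl
  | lam M ih =>
    simp only [rename, ih]
    congr 2; funext n; cases n <;> rfl
  | app M N ihM ihN => simp only [rename, ihM, ihN]

theorem subst_rename (ξ : ℕ → ℕ) (s : ℕ → Term) (M : Term) :
    subst s (rename ξ M) = subst (fun n => s (ξ n)) M := by
  induction M generalizing ξ s with
  | var n => rfl
  | bot => rfl
  | lam M ih =>
    simp only [rename, subst, ih]
    congr 2; funext n; cases n <;> rfl
  | app M N ihM ihN => simp only [rename, subst, ihM, ihN]

theorem rename_subst (ξ : ℕ → ℕ) (s : ℕ → Term) (M : Term) :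
    rename ξ (subst s M) = subst (fun n => rename ξ (s n)) M := by
  induction M generalizing ξ s with
  | var n => rfl
  | bot => rfl
  | lam M ih =>
    simp only [rename, subst, ih]
    congr 2; funext n
    cases n with
    | zero => rfl
    | succ n => simp only [up, rename_rename]; rfl
  | app M N ihM ihN => simp only [rename, subst, ihM, ihN]

theorem subst_subst (s t : ℕ → Term) (M : Term) :
    subst t (subst s M) = subst (fun n => subst t (s n)) M := by
  induction M generalizing s t with
  | var n => rfl
  | bot => rfl
  | lam M ih =>
    simp only [subst, ih]
    congr 2; funext n
    cases n with
    | zero => rfl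
    | succ n => simp only [up, subst_rename, rename_subst]
  | app M N ihM ihN => simp only [subst, ihM, ihN]

theorem subst_var (M : Term) : subst var M = M := by
  induction M with
  | var n => rfl
  | bot => rfl
  | lam M ih =>
    have : up var = var := by funext n; cases n <;> rfl
    simp only [subst, this, ih]
  | app M N ihM ihN => simp only [subst, ihM, ihN]

theorem rename_eq_subst (ξ : ℕ → ℕ) (M : Term) :
    rename ξ M = subst (fun n => var (ξ n)) M := by
  rw [← subst_rename, subst_var]

theorem inst_rename_succ (M N : Term) : inst (rename Nat.succ M) N = M := by
  rw [inst, subst_rename]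
  exact subst_var M

theorem subst_inst (s : ℕ → Term) (M N : Term) :
    subst s (inst M N) = inst (subst (up s) M) (subst s N) := by
  simp only [inst, subst_subst]
  congr 1; funext n
  cases n with
  | zero => rfl
  | succ n => exact (inst_rename_succ (s n) (subst s N)).symm

/-! ### Weak head reduction -/

/-- One step of weak head `β`-reduction. -/
inductive WH : Term → Term → Prop
  | beta (M N : Term) : WH (app (lam M) N) (inst M N)
  | appLeft {M M' : Term} (N : Term) : WH M M' → WH (app M N) (app M' N)

/-- Many-step weak head `β`-reduction. -/
abbrev WHs : Term → Term → Prop := ReflTransGen WH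

theorem WH.subst {M N : Term} (h : WH M N) (s : ℕ → Term) :
    WH (Term.subst s M) (Term.subst s N) := by
  induction h with
  | beta M N => rw [subst_inst]; exact .beta _ _
  | appLeft N _ ih => exact .appLeft _ ih

theorem WHs.subst {M N : Term} (h : WHs M N) (s : ℕ → Term) :
    WHs (Term.subst s M) (Term.subst s N) :=
  h.lift _ fun _ _ h => h.subst s

theorem WHs.appLeft {M M' : Term} (h : WHs M M') (N : Term) : WHs (app M N) (app M' N) :=
  h.lift (fun M => app M N) fun _ _ h => .appLeft N h

theorem WH.det {M N N' : Term} (h : WH M N) (h' : WH M N') : N = N' := by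
  induction h generalizing N' with
  | beta M N =>
    cases h' with
    | beta => rfl
    | appLeft _ h => cases h
  | appLeft N h ih =>
    cases h' with
    | beta => cases h
    | appLeft _ h' => rw [ih h']

theorem WHs.eq_of_normal {M N : Term} (h : WHs M N) (hM : ∀ N, ¬ WH M N) : N = M := by
  rcases h.cases_head with h | ⟨_, h, _⟩
  · exact h.symm
  · exact (hM _ h).elim

theorem WHs.of_normal {M N P : Term} (hN : WHs M N) (hP : WHs M P) (h : ∀ Q, ¬ WH P Q) :
    WHs N P := by
  induction hN using ReflTransGen.head_induction_on with
  | refl => exact hP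
  | head h₁ _ ih =>
    rcases hP.cases_head with rfl | ⟨Q, h₂, h₃⟩
    · exact (h _ h₁).elim
    · exact ih (h₁.det h₂ ▸ h₃)

/-! ### Standardization -/

/-- Standard `β⊥`-reduction. -/
inductive St : Term → Term → Prop
  | var {M : Term} {n : ℕ} : WHs M (var n) → St M (var n)
  | bot {M : Term} : WHs M bot → St M bot
  | lam {M P P' : Term} : WHs M (lam P) → St P P' → St M (lam P')
  | app {M P P' Q Q' : Term} : WHs M (app P Q) → St P P' → St Q Q' → St M (app P' Q')
  | botLam {M P : Term} : WHs M (lam P) → St P bot → St M bot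
  | botApp {M P Q : Term} : WHs M (app P Q) → St P bot → St M bot

theorem St.refl (M : Term) : St M M := by
  induction M with
  | var n => exact .var .refl
  | bot => exact .bot .refl
  | lam M ih => exact .lam .refl ih
  | app M N ihM ihN => exact .app .refl ihM ihN

theorem St.head {M M' N : Term} (h : WHs M M') (h' : St M' N) : St M N := by
  cases h' with
  | var h₁ => exact .var (h.trans h₁)
  | bot h₁ => exact .bot (h.trans h₁)
  | lam h₁ h₂ => exact .lam (h.trans h₁) h₂
  | app h₁ h₂ h₃ => exact .app (h.trans h₁) h₂ h₃
  | botLam h₁ h₂ => exact .botLam (h.trans h₁) h₂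
  | botApp h₁ h₂ => exact .botApp (h.trans h₁) h₂

/-- The relation `C` is a parameter because the induction serves twice: with equality it gives
stability under renaming, which is then needed to show that pointwise `St` is closed under `up`. -/
theorem St.subst_of_up {M N : Term} (h : St M N) {C : (ℕ → Term) → (ℕ → Term) → Prop}
    (hC : ∀ s t, C s t → ∀ n, St (s n) (t n)) (hup : ∀ s t, C s t → C (up s) (up t))
    {s t : ℕ → Term} (hst : C s t) : St (Term.subst s M) (Term.subst t N) := by
  induction h generalizing s t with
  | var h => exact (hC s t hst _).head (h.subst s)
  | bot h => exact .bot (h.subst s)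
  | lam h _ ih => exact .lam (h.subst s) (ih (hup s t hst))
  | app h _ _ ih₁ ih₂ => exact .app (h.subst s) (ih₁ hst) (ih₂ hst)
  | botLam h _ ih => exact .botLam (h.subst s) (ih (hup s t hst))
  | botApp h _ ih => exact .botApp (h.subst s) (ih hst)

theorem St.rename {M N : Term} (h : St M N) (ξ : ℕ → ℕ) :
    St (Term.rename ξ M) (Term.rename ξ N) := by
  rw [rename_eq_subst, rename_eq_subst]
  refine h.subst_of_up (C := fun s t => s = t) (fun s t h n => h ▸ .refl _)
    (fun s t h => h ▸ rfl) rfl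

theorem St.subst {M N : Term} (h : St M N) {s t : ℕ → Term} (hst : ∀ n, St (s n) (t n)) :
    St (Term.subst s M) (Term.subst t N) := by
  refine h.subst_of_up (C := fun s t => ∀ n, St (s n) (t n)) (fun _ _ h => h) ?_ hst
  intro s t h n
  cases n with
  | zero => exact .refl _
  | succ n => exact (h n).rename _

theorem St.inst {M M' N N' : Term} (hM : St M M') (hN : St N N') :
    St (Term.inst M N) (Term.inst M' N') :=
  hM.subst fun n => by
    cases n with
    | zero => exact hN
    | succ n => exact .refl _

theorem St.step {M N N' : Term} (h : St M N) (h' : Step N N') : St M N' := by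
  induction h generalizing N' with
  | var _ => cases h'
  | bot _ => cases h'
  | lam h₁ h₂ ih =>
    cases h' with
    | botLam => exact .botLam h₁ h₂
    | lam h' => exact .lam h₁ (ih h')
  | app h₁ h₂ h₃ ih₂ ih₃ =>
    cases h' with
    | beta =>
      cases h₂ with
      | lam h₄ h₅ =>
        -- A standard reduction to an abstraction exposes a `λ` by weak head steps, so the new redex
        -- can be contracted as a head redex of the source.
        exact (h₅.inst h₃).head ((h₁.trans (h₄.appLeft _)).tail (.beta _ _))
    | botApp => exact .botApp h₁ h₂
    | appLeft _ h' => exact .app h₁ (ih₂ h') h₃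
    | appRight _ h' => exact .app h₁ h₂ (ih₃ h')
  | botLam _ _ _ => cases h'
  | botApp _ _ _ => cases h'

theorem Reduces.st {M N : Term} (h : Reduces M N) : St M N := by
  induction h with
  | refl => exact .refl _
  | tail _ h ih => exact ih.step h

/-! ### Applicative spines -/

/-- `Spine H m T`: the term `T` is `H N₁ … N_m`. -/
inductive Spine (H : Term) : ℕ → Term → Prop
  | nil : Spine H 0 H
  | app {m : ℕ} {P : Term} (N : Term) : Spine H m P → Spine H (m + 1) (app P N)

theorem Spine.subst {H T : Term} {m : ℕ} (h : Spine H m T) (s : ℕ → Term) :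
    Spine (Term.subst s H) m (Term.subst s T) := by
  induction h with
  | nil => exact .nil
  | app N _ ih => exact .app _ ih

theorem Spine.normal {H T U : Term} {m : ℕ} (h : Spine H m T) (hH : ∀ U, ¬ WH H U)
    (hlam : ∀ P, H ≠ lam P) : ¬ WH T U := by
  induction h generalizing U with
  | nil => exact hH U
  | app N h ih =>
    intro h'
    cases h' with
    | beta =>
      cases h
      exact hlam _ rfl
    | appLeft _ h' => exact ih h'

theorem spine_or_wh (T : Term) :
    (∃ i m, Spine (var i) m T) ∨ (∃ U, WH T U) ∨ (∃ P, T = lam P) ∨ ∃ m, Spine bot m T := by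
  induction T with
  | var n => exact .inl ⟨n, 0, .nil⟩
  | bot => exact .inr (.inr (.inr ⟨0, .nil⟩))
  | lam M _ => exact .inr (.inr (.inl ⟨M, rfl⟩))
  | app M N ih _ =>
    rcases ih with ⟨i, m, h⟩ | ⟨U, h⟩ | ⟨P, rfl⟩ | ⟨m, h⟩
    · exact .inl ⟨i, m + 1, h.app N⟩
    · exact .inr (.inl ⟨_, h.appLeft N⟩)
    · exact .inr (.inl ⟨_, .beta P N⟩)
    · exact .inr (.inr (.inr ⟨m + 1, h.app N⟩))

/-- If a substitution instance of `Q` weak head reduces to a variable, then `Q` weak head reduces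
to a term with a head variable. -/
theorem WHs.exists_spine {T : Term} {k : ℕ} (h : WHs T (var k)) {s : ℕ → Term} {Q : Term}
    (hT : T = Term.subst s Q) :
    ∃ i m Q', WHs Q Q' ∧ Spine (var i) m Q' ∧ WHs (Term.subst s Q') (var k) := by
  induction h using ReflTransGen.head_induction_on generalizing Q with
  | refl =>
    cases Q with
    | var n => exact ⟨n, 0, _, .refl, .nil, hT ▸ .refl⟩
    | _ => cases hT
  | head h₁ h₂ ih =>
    subst hT
    rcases spine_or_wh Q with ⟨i, m, h⟩ | ⟨U, h⟩ | ⟨P, rfl⟩ | ⟨m, h⟩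
    · exact ⟨i, m, Q, .refl, h, h₂.head h₁⟩
    -- By determinism, the step of the instance is the instance of the step of `Q`.
    · obtain ⟨i, m, Q', h₃, h₄⟩ := ih (h₁.det (h.subst s))
      exact ⟨i, m, Q', h₃.head h, h₄⟩
    · cases h₁
    -- A spine with head `⊥` is stuck under every substitution.
    · exact ((h.subst s).normal (fun _ h => nomatch h) (fun _ h => nomatch h) h₁).elim

theorem WHs.app_cases {A B T : Term} (h : WHs (app A B) T) :
    (∃ A', WHs A A' ∧ T = app A' B) ∨ ∃ A', WHs A (lam A') := by
  induction h with
  | refl => exact .inl ⟨A, .refl, rfl⟩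
  | tail _ h ih =>
    rcases ih with ⟨A', h₁, rfl⟩ | h₁
    · cases h with
      | beta => exact .inr ⟨_, h₁⟩
      | appLeft _ h => exact .inl ⟨_, h₁.tail h, rfl⟩
    · exact .inr h₁

/-! ### Right invertible terms -/

theorem comp_whs (M R : Term) :
    WHs (comp M R) (lam (app (rename Nat.succ M) (app (rename Nat.succ R) (var 0)))) := by
  have h₁ : WH (app B M) (lam (lam (app (rename Nat.succ (rename Nat.succ M))
      (app (var 1) (var 0))))) := .beta _ _
  have h₂ : WH (app (lam (lam (app (rename Nat.succ (rename Nat.succ M))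
      (app (var 1) (var 0))))) R)
      (lam (app (rename Nat.succ M) (app (rename Nat.succ R) (var 0)))) := by
    have h := WH.beta (lam (app (rename Nat.succ (rename Nat.succ M)) (app (var 1) (var 0)))) R
    have e : subst (up (single R)) (rename Nat.succ (rename Nat.succ M)) = rename Nat.succ M := by
      rw [rename_rename, subst_rename, rename_eq_subst]
      rfl
    simp only [inst, subst, e] at h
    exact h
  exact .head (.appLeft R h₁) (.single h₂)

theorem RightInvertible.exists_spine {M : Term} (h : M.RightInvertible) :
    ∃ m Q, WHs (app (rename Nat.succ M) (var 0)) Q ∧ Spine (var 0) m Q := by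
  obtain ⟨R, P, h₁, h₂⟩ := h
  have hP : P = lam (var 0) := by
    rcases h₂.cases_head with h | ⟨_, h, _⟩
    · exact h.symm
    · cases h with
      | lam h => cases h
  subst hP
  cases h₁.st with
  | lam h₃ h₄ =>
    -- Abstractions are weak head normal, so by determinism the one given by standardization is
    -- `λx.M(Rx)`.
    have e := ((comp_whs M R).of_normal h₃ fun _ h => nomatch h).eq_of_normal fun _ h => nomatch h
    injection e with e
    cases h₄ with
    | var h₅ =>
      subst e
      -- The substitution puts `Rx` for variable `0` and fixes the others; the shifted `M` does not
      -- contain variable `0`.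
      have e' : app (rename Nat.succ M) (app (rename Nat.succ R) (var 0)) =
          subst (fun n => Nat.casesOn n (app (rename Nat.succ R) (var 0)) fun n => var (n + 1))
            (app (rename Nat.succ M) (var 0)) := by
        rw [subst, subst_rename, rename_eq_subst Nat.succ M]
        rfl
      obtain ⟨i, m, Q, h₆, h₇, h₈⟩ := h₅.exists_spine e'
      cases i with
      | zero => exact ⟨m, Q, h₆, h₇⟩
      | succ i =>
        have h₉ := h₇.subst
          (fun n => Nat.casesOn n (app (rename Nat.succ R) (var 0)) fun n => var (n + 1))
        have e'' := h₈.eq_of_normal fun _ h =>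
          h₉.normal (fun _ h => nomatch h) (fun _ h => nomatch h) h
        rw [← e''] at h₉
        cases h₉

/-- The term `λx₁ … x_m.T`, where no `x_i` is free in `T`. -/
def constLam : ℕ → Term → Term
  | 0, T => T
  | m + 1, T => lam (constLam m (rename Nat.succ T))

theorem subst_constLam (s : ℕ → Term) (m : ℕ) (T : Term) :
    subst s (constLam m T) = constLam m (subst s T) := by
  induction m generalizing s T with
  | zero => rfl
  | succ m ih =>
    simp only [constLam, subst, ih, subst_rename, rename_subst]
    rfl

/-- The head discards the `m` arguments one by one; the surplus `k` counts the abstractions still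
waiting and makes the induction go through. -/
theorem Spine.reduces_subst {i m : ℕ} {T : Term} (h : Spine (var i) m T) {s : ℕ → Term}
    {k : ℕ} {Z : Term} (hs : Reduces (s i) (constLam (m + k) Z)) :
    Reduces (Term.subst s T) (constLam k Z) := by
  induction h generalizing k with
  | nil => rwa [Nat.zero_add] at hs
  | @app m P N _ ih =>
    have h₁ := ih (k := k + 1) (by rwa [Nat.add_right_comm] at hs)
    have h₂ : Reduces (Term.subst s (Term.app P N))
        (Term.app (constLam (k + 1) Z) (Term.subst s N)) :=
      ReflTransGen.lift (fun M => Term.app M (Term.subst s N)) (fun _ _ h => Step.appLeft _ h) _ _ h₁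
    have h₃ := Step.beta (constLam k (Term.rename Nat.succ Z)) (Term.subst s N)
    rw [Term.inst, subst_constLam] at h₃
    have e : Term.subst (single (Term.subst s N)) (Term.rename Nat.succ Z) = Z :=
      inst_rename_succ _ _
    rw [e] at h₃
    exact h₂.tail h₃

theorem WH.step {M N : Term} (h : WH M N) : Step M N := by
  induction h with
  | beta M N => exact .beta M N
  | appLeft N _ ih => exact .appLeft N ih

theorem Spine.rightInvertible {m : ℕ} {T : Term} (h : Spine (var 0) m T) :
    (lam T).RightInvertible := by
  -- The right inverse `λy x₁ … x_m.y`: put in head position, it throws away the `m` arguments of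
  -- the spine.
  refine ⟨lam (constLam m (var 0)), I, ?_, .refl⟩
  have h₁ : Reduces (comp (lam T) (lam (constLam m (var 0)))) _ :=
    ReflTransGen.mono (fun _ _ h => WH.step h) _ _ (comp_whs _ _)
  refine h₁.trans (ReflTransGen.lift lam (fun _ _ h => Step.lam h) _ _ (?_ : Reduces _ (var 0)))
  refine .head (.beta _ _) ?_
  rw [Term.inst, subst_rename]
  refine h.reduces_subst (k := 0) (Z := var 0) (.single ?_)
  have h₂ := Step.beta (constLam m (var 0)) (var 0)
  rw [Term.inst, subst_constLam] at h₂
  have e : rename Nat.succ (lam (constLam m (var 0))) = lam (constLam m (var 0)) := by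
    rw [rename_eq_subst, Term.subst, subst_constLam]
    rfl
  change Step (Term.app (rename Nat.succ (lam (constLam m (var 0)))) (var 0)) _
  rw [e]
  exact h₂

end Term

/-! ### Subtyping -/

/-- The strict types equivalent to `ω`. -/
def IsTop : Strict → Prop
  | .var _ => False
  | .omega => True
  | .arrow _ μ => IsTop μ

theorem IsTop.le {μ : Strict} (h : IsTop μ) (σ : Inter) : Le σ (.strict μ) := by
  match μ with
  | .var _ => exact h.elim
  | .omega => exact .omega σ
  | .arrow τ μ =>
    exact (Le.omega σ).trans (.trans .omegaArrow
      (.arrow (.omega τ) (IsTop.le (μ := μ) h (.strict .omega))))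

theorem Le.isTop {σ τ : Inter} (h : Le σ τ) (hσ : ∀ μ ∈ σ.components, IsTop μ) :
    ∀ ν ∈ τ.components, IsTop ν := by
  induction h with
  | refl => exact hσ
  | trans _ _ ih₁ ih₂ => exact ih₂ (ih₁ hσ)
  | idem => simpa [Inter.components] using hσ
  | omega => simp [Inter.components, IsTop]
  | omegaArrow => simp [Inter.components, IsTop]
  | interLeft => exact fun ν h => hσ ν (List.mem_append_left _ h)
  | interRight => exact fun ν h => hσ ν (List.mem_append_right _ h)
  | inter _ _ ih₁ ih₂ =>
    intro ν h
    rcases List.mem_append.1 h with h | h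
    · exact ih₁ (fun μ h => hσ μ (List.mem_append_left _ h)) ν h
    · exact ih₂ (fun μ h => hσ μ (List.mem_append_right _ h)) ν h
  | arrow _ _ _ ih =>
    simpa [Inter.components, IsTop] using ih (by simpa [Inter.components, IsTop] using hσ)

theorem Le.isTop_strict {μ ν : Strict} (h : Le (.strict μ) (.strict ν)) (hμ : IsTop μ) :
    IsTop ν :=
  h.isTop (by simpa [Inter.components] using hμ) ν (by simp [Inter.components])

theorem Inter.le_of_mem {σ : Inter} {μ : Strict} (h : μ ∈ σ.components) :
    Le σ (.strict μ) := by
  match σ with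
  | .strict ν =>
    obtain rfl : μ = ν := by simpa [Inter.components] using h
    exact .refl _
  | .inter σ τ =>
    rcases List.mem_append.1 h with h | h
    · exact (Le.interLeft σ τ).trans (Inter.le_of_mem h)
    · exact (Le.interRight σ τ).trans (Inter.le_of_mem h)

theorem Inter.exists_mem_components (σ : Inter) : ∃ μ, μ ∈ σ.components := by
  match σ with
  | .strict μ => exact ⟨μ, List.mem_singleton_self μ⟩
  | .inter σ τ =>
    obtain ⟨μ, h⟩ := σ.exists_mem_components
    exact ⟨μ, List.mem_append_left _ h⟩

/-- The subtype relation between strict types, in a form suitable for inversion. -/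
def StrictLe (μ ν : Strict) : Prop :=
  IsTop ν ∨ μ = ν ∨ ∃ σ₁ σ₂ μ₁ μ₂, μ = .arrow σ₁ μ₁ ∧ ν = .arrow σ₂ μ₂ ∧
    Le σ₂ σ₁ ∧ Le (.strict μ₁) (.strict μ₂)

theorem StrictLe.le {μ ν : Strict} (h : StrictLe μ ν) : Le (.strict μ) (.strict ν) := by
  rcases h with h | rfl | ⟨σ₁, σ₂, μ₁, μ₂, rfl, rfl, h₁, h₂⟩
  · exact h.le _
  · exact .refl _
  · exact .arrow h₁ h₂

theorem StrictLe.trans {μ ν κ : Strict} (h : StrictLe μ ν) (h' : StrictLe ν κ) :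
    StrictLe μ κ := by
  rcases h' with h' | rfl | h'
  · exact .inl h'
  · exact h
  · rcases h with h | rfl | h
    · exact .inl (StrictLe.le (.inr (.inr h')) |>.isTop_strict h)
    · exact .inr (.inr h')
    · obtain ⟨σ₁, σ₂, μ₁, μ₂, rfl, rfl, h₁, h₂⟩ := h
      obtain ⟨_, σ₃, _, μ₃, e, rfl, h₃, h₄⟩ := h'
      injection e with e₁ e₂
      subst e₁ e₂
      exact .inr (.inr ⟨σ₁, σ₃, μ₁, μ₃, rfl, rfl, h₃.trans h₁, h₂.trans h₄⟩)

/-- No rule merges several arrows into one, so a component on the right always lies above a single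
component on the left. All inversion of subtyping rests on this. -/
theorem Le.exists_strictLe {σ τ : Inter} (h : Le σ τ) :
    ∀ ν ∈ τ.components, ∃ μ ∈ σ.components, StrictLe μ ν := by
  induction h with
  | refl => exact fun ν h => ⟨ν, h, .inr (.inl rfl)⟩
  | trans _ _ ih₁ ih₂ =>
    intro ν h
    obtain ⟨κ, hκ, h₁⟩ := ih₂ ν h
    obtain ⟨μ, hμ, h₂⟩ := ih₁ κ hκ
    exact ⟨μ, hμ, h₂.trans h₁⟩
  | idem => exact fun ν h => ⟨ν, by simpa [Inter.components] using h, .inr (.inl rfl)⟩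
  | omega σ =>
    intro ν h
    obtain ⟨μ, hμ⟩ := σ.exists_mem_components
    obtain rfl : ν = .omega := by simpa [Inter.components] using h
    exact ⟨μ, hμ, .inl trivial⟩
  | omegaArrow => exact fun ν h => ⟨.omega, by simp [Inter.components], .inl (by
      obtain rfl := List.mem_singleton.1 h
      exact trivial)⟩
  | interLeft => exact fun ν h => ⟨ν, List.mem_append_left _ h, .inr (.inl rfl)⟩
  | interRight => exact fun ν h => ⟨ν, List.mem_append_right _ h, .inr (.inl rfl)⟩
  | inter _ _ ih₁ ih₂ =>
    intro ν h
    rcases List.mem_append.1 h with h | h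
    · obtain ⟨μ, hμ, h⟩ := ih₁ ν h
      exact ⟨μ, List.mem_append_left _ hμ, h⟩
    · obtain ⟨μ, hμ, h⟩ := ih₂ ν h
      exact ⟨μ, List.mem_append_right _ hμ, h⟩
  | arrow h₁ h₂ =>
    intro ν h
    obtain rfl := List.mem_singleton.1 h
    exact ⟨_, List.mem_singleton_self _, .inr (.inr ⟨_, _, _, _, rfl, rfl, h₁, h₂⟩)⟩

theorem Le.strictLe {μ ν : Strict} (h : Le (.strict μ) (.strict ν)) : StrictLe μ ν := by
  obtain ⟨μ', h₁, h₂⟩ := h.exists_strictLe ν (List.mem_singleton_self ν)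
  obtain rfl := List.mem_singleton.1 h₁
  exact h₂

/-! ### Typing -/

theorem Typed.of_isTop {Γ : List Inter} {M : Term} {μ : Strict} (h : IsTop μ) : Typed Γ M μ :=
  .sub (.omega Γ M) (h.le _)

theorem Typed.of_le {Γ : List Inter} {M : Term} {σ τ : Inter} (h : Le σ τ)
    (hM : ∀ μ ∈ σ.components, Typed Γ M μ) : ∀ ν ∈ τ.components, Typed Γ M ν := by
  intro ν hν
  obtain ⟨μ, hμ, h'⟩ := h.exists_strictLe ν hν
  exact .sub (hM μ hμ) h'.le

theorem Typed.rename {Γ : List Inter} {M : Term} {μ : Strict} (h : Typed Γ M μ)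
    {Δ : List Inter} {ξ : ℕ → ℕ} (hξ : ∀ n σ, Γ[n]? = some σ → Δ[ξ n]? = some σ) :
    Typed Δ (Term.rename ξ M) μ := by
  induction h generalizing Δ ξ with
  | ax h₁ h₂ => exact .ax (hξ _ _ h₁) h₂
  | omega => exact .omega _ _
  | sub _ h ih => exact .sub (ih hξ) h
  | arrowI _ ih =>
    refine .arrowI (ih fun n σ h => ?_)
    cases n with
    | zero => exact h
    | succ n => exact hξ n σ h
  | arrowE _ _ ih₁ ih₂ => exact .arrowE (ih₁ hξ) fun ν hν => ih₂ ν hν hξ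

theorem Typed.weaken {Γ : List Inter} {M : Term} {μ : Strict} (h : Typed Γ M μ) (σ : Inter) :
    Typed (σ :: Γ) (Term.rename Nat.succ M) μ :=
  h.rename fun _ _ h => h

theorem Typed.subst {Γ : List Inter} {M : Term} {μ : Strict} (h : Typed Γ M μ)
    {Δ : List Inter} {s : ℕ → Term}
    (hs : ∀ n σ, Γ[n]? = some σ → ∀ ν ∈ σ.components, Typed Δ (s n) ν) :
    Typed Δ (Term.subst s M) μ := by
  induction h generalizing Δ s with
  | ax h₁ h₂ => exact hs _ _ h₁ _ h₂
  | omega => exact .omega _ _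
  | sub _ h ih => exact .sub (ih hs) h
  | @arrowI Γ M τ _ _ ih =>
    refine .arrowI (ih fun n σ h ν hν => ?_)
    cases n with
    | zero => exact .ax h hν
    | succ n => exact (hs n σ h ν hν).weaken τ
  | arrowE _ _ ih₁ ih₂ => exact .arrowE (ih₁ hs) fun ν hν => ih₂ ν hν hs

theorem Typed.narrow {Γ : List Inter} {M : Term} {μ : Strict} {σ τ : Inter}
    (h : Typed (σ :: Γ) M μ) (hτ : Le τ σ) : Typed (τ :: Γ) M μ := by
  -- Narrowing is the identity substitution, typed in the stronger environment.
  rw [← Term.subst_var M]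
  refine h.subst fun n ρ h ν hν => ?_
  cases n with
  | zero =>
    obtain rfl : σ = ρ := by simpa using h
    exact Typed.of_le hτ (fun μ hμ => .ax rfl hμ) ν hν
  | succ n => exact .ax h hν

theorem Typed.inst {Γ : List Inter} {M N : Term} {μ : Strict} {σ : Inter}
    (hM : Typed (σ :: Γ) M μ) (hN : ∀ ν ∈ σ.components, Typed Γ N ν) :
    Typed Γ (Term.inst M N) μ := by
  refine hM.subst fun n ρ h ν hν => ?_
  cases n with
  | zero =>
    obtain rfl : σ = ρ := by simpa using h
    exact hN ν hν
  | succ n => exact .ax h hν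

theorem Typed.var_inv {Γ : List Inter} {n : ℕ} {ν : Strict} (h : Typed Γ (.var n) ν) :
    IsTop ν ∨ ∃ σ, Γ[n]? = some σ ∧ Le σ (.strict ν) := by
  generalize e : Term.var n = T at h
  induction h with
  | ax h₁ h₂ =>
    cases e
    exact .inr ⟨_, h₁, Inter.le_of_mem h₂⟩
  | omega => exact .inl trivial
  | sub _ h ih =>
    rcases ih e with h' | ⟨σ, h₁, h₂⟩
    · exact .inl (h.isTop_strict h')
    · exact .inr ⟨σ, h₁, h₂.trans h⟩
  | arrowI => cases e
  | arrowE => cases e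

theorem Typed.lam_inv {Γ : List Inter} {M : Term} {ν : Strict} (h : Typed Γ (.lam M) ν) :
    IsTop ν ∨ ∃ σ μ, ν = .arrow σ μ ∧ Typed (σ :: Γ) M μ := by
  generalize e : Term.lam M = T at h
  induction h with
  | ax => cases e
  | omega => exact .inl trivial
  | sub _ h ih =>
    rcases ih e with h' | ⟨σ, μ, rfl, h'⟩
    · exact .inl (h.isTop_strict h')
    · rcases h.strictLe with h | rfl | ⟨_, σ₂, _, μ₂, e', rfl, h₁, h₂⟩
      · exact .inl h
      · exact .inr ⟨σ, μ, rfl, h'⟩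
      · injection e' with e₁ e₂
        subst e₁ e₂
        exact .inr ⟨σ₂, μ₂, rfl, (h'.narrow h₁).sub h₂⟩
  | arrowI h =>
    cases e
    exact .inr ⟨_, _, rfl, h⟩
  | arrowE => cases e

theorem Typed.lam_arrow_inv {Γ : List Inter} {M : Term} {σ : Inter} {μ : Strict}
    (h : Typed Γ (.lam M) (.arrow σ μ)) : Typed (σ :: Γ) M μ := by
  rcases h.lam_inv with h | ⟨_, _, e, h⟩
  · exact .of_isTop (μ := μ) h
  · injection e with e₁ e₂
    subst e₁ e₂
    exact h

/-- Subsumption is absorbed in the target of the arrow. The case of `ω` is no exception, since every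
term also has type `ω → ω`. -/
theorem Typed.app_inv {Γ : List Inter} {M N : Term} {ν : Strict} (h : Typed Γ (.app M N) ν) :
    ∃ σ, Typed Γ M (.arrow σ ν) ∧ ∀ μ ∈ σ.components, Typed Γ N μ := by
  generalize e : Term.app M N = T at h
  induction h with
  | ax => cases e
  | omega =>
    refine ⟨.strict .omega, .of_isTop (μ := .arrow (.strict .omega) .omega) trivial, ?_⟩
    intro μ hμ
    obtain rfl := List.mem_singleton.1 hμ
    exact .omega _ _
  | sub _ h ih =>
    obtain ⟨σ, h₁, h₂⟩ := ih e
    exact ⟨σ, h₁.sub (.arrow (.refl σ) h), h₂⟩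
  | arrowI => cases e
  | arrowE h₁ h₂ =>
    cases e
    exact ⟨_, h₁, h₂⟩

/-- Subject reduction is needed for weak head β-steps only; standardization has removed the
`⊥`-rules. -/
theorem Typed.wh {Γ : List Inter} {M N : Term} {μ : Strict} (hM : Typed Γ M μ)
    (h : Term.WH M N) : Typed Γ N μ := by
  induction h generalizing μ with
  | beta M N =>
    obtain ⟨σ, h₁, h₂⟩ := hM.app_inv
    exact h₁.lam_arrow_inv.inst h₂
  | appLeft N _ ih =>
    obtain ⟨σ, h₁, h₂⟩ := hM.app_inv
    exact .arrowE (ih h₁) h₂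

theorem Typed.whs {Γ : List Inter} {M N : Term} {μ : Strict} (hM : Typed Γ M μ)
    (h : Term.WHs M N) : Typed Γ N μ := by
  induction h with
  | refl => exact hM
  | tail _ h ih => exact ih.wh h

theorem arrows_append (ρs : List Inter) (σ : Inter) (μ : Strict) :
    arrows (ρs ++ [σ]) μ = arrows ρs (.arrow σ μ) := by
  induction ρs with
  | nil => rfl
  | cons ρ ρs ih => simp only [List.cons_append, arrows, ih]

theorem isTop_arrows (ρs : List Inter) (μ : Strict) : IsTop (arrows ρs μ) ↔ IsTop μ := by
  induction ρs with
  | nil => rfl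
  | cons ρ ρs ih => exact ih

/-- A typing of `x N₁ … N_m` from a single assumption on `x` yields a right arrow type. -/
theorem Typed.isRightArrow {τ : Inter} {T : Term} {μ : Strict} {m : ℕ} (h : Typed [τ] T μ)
    (hT : Term.Spine (.var 0) m T) : IsRightArrow τ μ := by
  induction hT generalizing μ with
  | nil =>
    refine ⟨[], ?_, by simp⟩
    rcases h.var_inv with h | ⟨σ, e, h⟩
    · exact h.le τ
    · obtain rfl : τ = σ := by simpa using e
      exact h
  | app N _ ih =>
    obtain ⟨σ, h₁, h₂⟩ := h.app_inv
    obtain ⟨ρs, h₃, h₄⟩ := ih h₁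
    refine ⟨ρs ++ [σ], by rwa [arrows_append], fun ρ hρ => ?_⟩
    rcases List.mem_append.1 hρ with hρ | hρ
    · exact h₄ ρ hρ
    · obtain rfl := List.mem_singleton.1 hρ
      -- One term `λx.N` serves all components of `σ`, and it is typed in the empty environment
      -- because `x` is the only assumption.
      exact ⟨.lam N, fun ν hν => .arrowI (h₂ ν hν)⟩

theorem Inhabits.isRightArrow {M : Term} {τ : Inter} {μ : Strict} (hM : M.RightInvertible)
    (h : Inhabits M (.arrow τ μ)) : IsRightArrow τ μ := by
  obtain ⟨m, Q, h₁, h₂⟩ := hM.exists_spine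
  have h₃ : Typed [τ] (.app (Term.rename Nat.succ M) (.var 0)) μ :=
    .arrowE (Typed.weaken h τ) fun ν hν => .ax rfl hν
  exact (h₃.whs h₁).isRightArrow h₂

theorem Term.RightInvertible.not_inhabits_var {M : Term} (hM : M.RightInvertible) (n : ℕ) :
    ¬ Inhabits M (.var n) := by
  intro h
  obtain ⟨m, Q, h₁, h₂⟩ := hM.exists_spine
  -- With `x : ω`, a spine headed by `x` only gets types equivalent to `ω`. Otherwise `M` reduces to
  -- an abstraction, whose types are arrows or equivalent to `ω`.
  have h₃ := Typed.weaken h (.strict .omega)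
  rcases h₁.app_cases with ⟨A, h₄, rfl⟩ | ⟨A, h₄⟩
  · cases h₂ with
    | app _ h₂ =>
      obtain ⟨ρs, h₅, -⟩ := (h₃.whs h₄).isRightArrow h₂
      exact (isTop_arrows ρs (.var n)).1 (h₅.isTop_strict trivial)
  · rcases (h₃.whs h₄).lam_inv with h | ⟨_, _, e, _⟩
    · exact h
    · cases e

theorem Inhabits.isRightType {M : Term} {ν : Strict} (hM : M.RightInvertible)
    (h : Inhabits M ν) : IsRightType ν := by
  match ν with
  | .var n => exact (hM.not_inhabits_var n h).elim
  | .omega =>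
    exact ⟨.strict .omega, .omega, ⟨.omegaArrow, .omega _⟩, [], .refl _, by simp⟩
  | .arrow τ μ => exact ⟨τ, μ, ⟨.refl _, .refl _⟩, h.isRightArrow hM⟩

/-! ### Right types are inhabited -/

theorem exists_spine_typed {τ : Inter} {T : Term} {m : ℕ} (hT : Term.Spine (.var 0) m T)
    (ρs : List Inter) (hρs : ∀ ρ ∈ ρs, ArrowInhabited τ ρ) {μ : Strict}
    (h : Typed [τ] T (arrows ρs μ)) :
    ∃ m' T', Term.Spine (.var 0) m' T' ∧ Typed [τ] T' μ := by
  induction ρs generalizing T m with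
  | nil => exact ⟨m, T, hT, h⟩
  | cons ρ ρs ih =>
    obtain ⟨N, hN⟩ := hρs ρ List.mem_cons_self
    -- The next argument of the spine is `N x`, of type `ρ` under `x : τ`.
    refine ih (hT.app (.app (Term.rename Nat.succ N) (.var 0)))
      (fun ρ h => hρs ρ (List.mem_cons_of_mem _ h)) (.arrowE h fun ν hν => ?_)
    exact .arrowE (Typed.weaken (hN ν hν) τ) fun κ hκ => .ax rfl hκ

theorem IsRightType.exists_rightInvertible {ν : Strict} (h : IsRightType ν) :
    ∃ M : Term, M.RightInvertible ∧ Inhabits M ν := by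
  obtain ⟨τ, μ, h₁, ρs, h₂, h₃⟩ := h
  have h₄ : Typed [τ] (.var 0) (arrows ρs μ) :=
    Typed.of_le h₂ (fun κ hκ => .ax rfl hκ) _ (List.mem_singleton_self _)
  obtain ⟨m, T, h₅, h₆⟩ := exists_spine_typed .nil ρs h₃ h₄
  exact ⟨.lam T, h₅.rightInvertible, .sub (.arrowI h₆) h₁.2⟩

end LamBot

theorem mainTheorem8 :
    (∀ (M : LamBot.Term) (ν : LamBot.Strict),
      M.RightInvertible → LamBot.Inhabits M ν → LamBot.IsRightType ν) ∧
    (∀ (M : LamBot.Term) (τ : LamBot.Inter) (μ : LamBot.Strict),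
      M.RightInvertible → LamBot.Inhabits M (.arrow τ μ) → LamBot.IsRightArrow τ μ) ∧
    (∀ ν : LamBot.Strict, LamBot.IsRightType ν →
      ∃ M : LamBot.Term, M.RightInvertible ∧ LamBot.Inhabits M ν) :=
  ⟨fun _ _ hM h => h.isRightType hM, fun _ _ _ hM h => h.isRightArrow hM,
    fun _ h => h.exists_rightInvertible⟩
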